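/- Let $\Theta=(\theta_{jk})$ be a real skew-symmetric $n\times n$ matrix. For $p,q\in\mathbb Z^n$ put $\sigma_\Theta(p,q)=\exp\bigl(-\pi i\sum_{j,k}\theta_{jk}p_jq_k\bigr)$. A rapidly decreasing function $\varphi:\mathbb Z^n\to\mathbb C$ acts on $\ell^2(\mathbb Z^n)$ by the deformed convolution $(\varphi*\xi)(p)=\sum_{q\in\mathbb Z^n}\varphi(q)\,\xi(p-q)\,\sigma_\Theta(q,p-q)$; these operators form a $*$-algebra, and the noncommutative torus $\overline{A}_\Theta$ is its norm closure in the bounded operators on $\ell^2(\mathbb Z^n)$. The flip is the $*$-automorphism of $\overline{A}_\Theta$ of order at most two that is determined by $\varphi\mapsto\varphi(-\,\cdot\,)$ (that is, by $f(x)\mapsto f(-x)$ for functions on the torus $\mathbb R^n/\mathbb Z^n$ with Fourier coefficients $\varphi$). The symmetrized noncommutative torus $\overline{A}_\Theta^{\sigma}$ is the fixed-point algebra of the flip, and $\overline{A}_\Theta\rtimes\mathbb Z_2$ is the crossed product $C^*$-algebra for the action of $\mathbb Z_2$ in which the non-identity element acts by the flip. Theorem 1. Assume that there is an entry $\theta_{jk}$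 of $\Theta$ such that $4\theta_{jk}$ is not an integer. Then $\overline{A}_\Theta^{\sigma}$ is (strongly) Morita equivalent to $\overline{A}_\Theta\rtimes\mathbb Z_2$; that is, there is an imprimitivity bimodule for these two $C^*$-algebras. -/

import Mathlib

open scoped BigOperators Matrix CStarAlgebra

noncomputable section

/-! ### Noncommutative tori -/

namespace NCTorus

variable {n : ℕ}

/-- The Hilbert space `ℓ²(ℤⁿ)`. -/
abbrev EllTwo (n : ℕ) : Type := lp (fun _ : Fin n → ℤ => ℂ) 2

/-- The bicharacter `(p, q) ↦ exp (-π i ∑ j k, θ_{jk} p_j q_k)` on `ℤⁿ`. -/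
def cocycle (Θ : Matrix (Fin n) (Fin n) ℝ) (p q : Fin n → ℤ) : ℂ :=
  Complex.exp (-(Real.pi * Complex.I * ((∑ j, ∑ k, Θ j k * (p j : ℝ) * (q k : ℝ) : ℝ) : ℂ)))

/-- Schwartz functions on `ℤⁿ`: the functions that decay faster than every polynomial. They are the
families of Fourier coefficients of the smooth functions on the torus `ℝⁿ / ℤⁿ`. -/
def IsSchwartz (φ : (Fin n → ℤ) → ℂ) : Prop :=
  ∀ k : ℕ, ∃ C : ℝ, ∀ p, (1 + ‖p‖) ^ k * ‖φ p‖ ≤ C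

/-- `T` is the operator `ξ ↦ φ * ξ` of deformed convolution by `φ` on `ℓ²(ℤⁿ)`. -/
def IsConvolutionBy (Θ : Matrix (Fin n) (Fin n) ℝ) (φ : (Fin n → ℤ) → ℂ)
    (T : EllTwo n →L[ℂ] EllTwo n) : Prop :=
  ∀ (ξ : EllTwo n) (p : Fin n → ℤ), T ξ p = ∑' q, φ q * ξ (p - q) * cocycle Θ q (p - q)

/-- The operators of deformed convolution by Schwartz functions. This is the image of the smooth
noncommutative torus in the bounded operators on `ℓ²(ℤⁿ)`. -/
def smoothOperators (Θ : Matrix (Fin n) (Fin n) ℝ) : Set (EllTwo n →L[ℂ] EllTwo n) :=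
  {T | ∃ φ, IsSchwartz φ ∧ IsConvolutionBy Θ φ T}

/-- The noncommutative torus as a C⋆-algebra: the norm closure, in the bounded operators
on `ℓ²(ℤⁿ)`, of the algebra of deformed convolutions by Schwartz functions. -/
def torus (Θ : Matrix (Fin n) (Fin n) ℝ) : StarSubalgebra ℂ (EllTwo n →L[ℂ] EllTwo n) :=
  (StarAlgebra.adjoin ℂ (smoothOperators Θ)).topologicalClosure

instance torus_isClosed (Θ : Matrix (Fin n) (Fin n) ℝ) :
    IsClosed (torus Θ : Set (EllTwo n →L[ℂ] EllTwo n)) :=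
  StarSubalgebra.isClosed_topologicalClosure _

instance torusCStarAlgebra (Θ : Matrix (Fin n) (Fin n) ℝ) : CStarAlgebra (torus Θ) :=
  StarSubalgebra.cstarAlgebra (torus Θ)

theorem memlp_neg (ξ : EllTwo n) : Memℓp (fun p : Fin n → ℤ => (ξ (-p) : ℂ)) 2 := by
  have h := lp.memℓp ξ
  rw [memℓp_gen_iff (by norm_num)] at h ⊢
  exact (Equiv.neg (Fin n → ℤ)).summable_iff.mpr h

/-- The unitary `(J ξ)(p) = ξ(-p)` on `ℓ²(ℤⁿ)`. -/
def reflection (n : ℕ) : EllTwo n ≃ₗᵢ[ℂ] EllTwo n where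
  toFun ξ := ⟨fun p => ξ (-p), memlp_neg ξ⟩
  invFun ξ := ⟨fun p => ξ (-p), memlp_neg ξ⟩
  left_inv ξ := by ext p; simp
  right_inv ξ := by ext p; simp
  map_add' ξ η := by ext p; rfl
  map_smul' c ξ := by ext p; rfl
  norm_map' ξ := by
    rw [lp.norm_eq_tsum_rpow (by norm_num), lp.norm_eq_tsum_rpow (by norm_num)]
    congr 1
    exact (Equiv.neg (Fin n → ℤ)).tsum_eq (fun p => ‖ξ p‖ ^ (2 : ENNReal).toReal)

@[simp] theorem reflection_apply (ξ : EllTwo n) (p : Fin n → ℤ) :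
    reflection n ξ p = ξ (-p) := rfl

@[simp] theorem reflection_symm_apply (ξ : EllTwo n) (p : Fin n → ℤ) :
    (reflection n).symm ξ p = ξ (-p) := rfl

/-- Conjugation by `J` on the bounded operators on `ℓ²(ℤⁿ)`. It takes the convolution by `φ` to the
convolution by `p ↦ φ (-p)` (see `conj_convolution`), that is, it implements `x ↦ -x`. -/
def conjReflection (n : ℕ) :
    (EllTwo n →L[ℂ] EllTwo n) ≃⋆ₐ[ℂ] (EllTwo n →L[ℂ] EllTwo n) :=
  (reflection n).conjStarAlgEquiv

theorem conjReflection_conjReflection (T : EllTwo n →L[ℂ] EllTwo n) :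
    conjReflection n (conjReflection n T) = T := by
  ext ξ p
  have : (reflection n).symm ((reflection n).symm ξ) = ξ := by ext q; simp
  simp [conjReflection, this]

theorem cocycle_neg_neg (Θ : Matrix (Fin n) (Fin n) ℝ) (p q : Fin n → ℤ) :
    cocycle Θ (-p) (-q) = cocycle Θ p q := by
  simp [cocycle]

theorem conj_convolution {Θ : Matrix (Fin n) (Fin n) ℝ} {φ : (Fin n → ℤ) → ℂ}
    {T : EllTwo n →L[ℂ] EllTwo n} (h : IsConvolutionBy Θ φ T) :
    IsConvolutionBy Θ (fun p => φ (-p)) (conjReflection n T) := by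
  intro ξ p
  simp only [conjReflection, LinearIsometryEquiv.conjStarAlgEquiv_apply_apply, reflection_apply]
  rw [h, ← (Equiv.neg (Fin n → ℤ)).tsum_eq]
  refine tsum_congr fun q => ?_
  have : -p - -q = -(p - q) := by abel
  simp only [Equiv.neg_apply, reflection_symm_apply, this, cocycle_neg_neg, neg_neg]

theorem conjReflection_mem_smooth {Θ : Matrix (Fin n) (Fin n) ℝ}
    {T : EllTwo n →L[ℂ] EllTwo n} (h : T ∈ smoothOperators Θ) :
    conjReflection n T ∈ smoothOperators Θ := by
  obtain ⟨φ, hφ, hT⟩ := h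
  refine ⟨fun p => φ (-p), fun k => ?_, conj_convolution hT⟩
  obtain ⟨C, hC⟩ := hφ k
  exact ⟨C, fun p => by simpa using hC (-p)⟩

theorem continuous_conjReflection : Continuous (conjReflection n) := by
  have : (conjReflection n : (EllTwo n →L[ℂ] EllTwo n) → (EllTwo n →L[ℂ] EllTwo n)) = fun T =>
      ((reflection n : EllTwo n →L[ℂ] EllTwo n)).comp
        (T.comp ((reflection n).symm : EllTwo n →L[ℂ] EllTwo n)) := by
    ext T; rfl
  rw [this]
  fun_prop

theorem conjReflection_mem_torus {Θ : Matrix (Fin n) (Fin n) ℝ}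
    {T : EllTwo n →L[ℂ] EllTwo n} (h : T ∈ torus Θ) : conjReflection n T ∈ torus Θ := by
  let f : (EllTwo n →L[ℂ] EllTwo n) →⋆ₐ[ℂ] (EllTwo n →L[ℂ] EllTwo n) :=
    StarAlgHomClass.toStarAlgHom (conjReflection n)
  have hle : torus Θ ≤ (torus Θ).comap f := by
    refine StarSubalgebra.topologicalClosure_minimal ?_ ?_
    · refine StarAlgebra.adjoin_le fun S hS => ?_
      exact StarSubalgebra.le_topologicalClosure _
        (StarAlgebra.subset_adjoin ℂ _ (conjReflection_mem_smooth hS))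
    · exact (torus_isClosed Θ).preimage continuous_conjReflection
  exact hle h

/-- The flip `x ↦ -x` on the noncommutative torus. -/
def flip (Θ : Matrix (Fin n) (Fin n) ℝ) : torus Θ ≃⋆ₐ[ℂ] torus Θ where
  toFun a := ⟨conjReflection n a, conjReflection_mem_torus a.2⟩
  invFun a := ⟨conjReflection n a, conjReflection_mem_torus a.2⟩
  left_inv _ := Subtype.ext (conjReflection_conjReflection _)
  right_inv _ := Subtype.ext (conjReflection_conjReflection _)
  map_mul' _ _ := Subtype.ext (map_mul (conjReflection n) _ _)
  map_add' _ _ := Subtype.ext (map_add (conjReflection n) _ _)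
  map_star' _ := Subtype.ext (map_star (conjReflection n) _)
  map_smul' c _ := Subtype.ext (map_smul (conjReflection n) c _)

theorem coe_flip (Θ : Matrix (Fin n) (Fin n) ℝ) (a : torus Θ) :
    (flip Θ a : EllTwo n →L[ℂ] EllTwo n) = conjReflection n a := rfl

theorem flip_flip (Θ : Matrix (Fin n) (Fin n) ℝ) (a : torus Θ) : flip Θ (flip Θ a) = a :=
  (flip Θ).left_inv a

theorem continuous_flip (Θ : Matrix (Fin n) (Fin n) ℝ) : Continuous (flip Θ) :=
  (continuous_conjReflection.comp continuous_subtype_val).subtype_mk _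

/-- The symmetrized noncommutative torus: the fixed-point algebra of the flip. -/
def symmetrizedTorus (Θ : Matrix (Fin n) (Fin n) ℝ) : StarSubalgebra ℂ (torus Θ) where
  carrier := {a | flip Θ a = a}
  mul_mem' {a b} (ha : flip Θ a = a) (hb : flip Θ b = b) := by simp [ha, hb]
  add_mem' {a b} (ha : flip Θ a = a) (hb : flip Θ b = b) := by simp [ha, hb]
  algebraMap_mem' c := by simp [Algebra.algebraMap_eq_smul_one]
  star_mem' {a} (ha : flip Θ a = a) := by simp [map_star, ha]

theorem mem_symmetrizedTorus {Θ : Matrix (Fin n) (Fin n) ℝ} {a : torus Θ} :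
    a ∈ symmetrizedTorus Θ ↔ flip Θ a = a := Iff.rfl

instance symmetrizedTorus_isClosed (Θ : Matrix (Fin n) (Fin n) ℝ) :
    IsClosed (symmetrizedTorus Θ : Set (torus Θ)) :=
  isClosed_eq (continuous_flip Θ) continuous_id

instance symmetrizedTorusCStarAlgebra (Θ : Matrix (Fin n) (Fin n) ℝ) :
    CStarAlgebra (symmetrizedTorus Θ) :=
  StarSubalgebra.cstarAlgebra (symmetrizedTorus Θ)

/-- The action of `ℤ/2` on the noncommutative torus whose non-trivial element acts by the flip. -/
def flipAction (Θ : Matrix (Fin n) (Fin n) ℝ) :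
    Multiplicative (ZMod 2) →* (torus Θ ≃⋆ₐ[ℂ] torus Θ) where
  toFun g := if g = 1 then 1 else flip Θ
  map_one' := if_pos rfl
  map_mul' g h := by
    have hsq : flip Θ * flip Θ = 1 := StarAlgEquiv.ext (flip_flip Θ)
    have key : ∀ g h : Multiplicative (ZMod 2), g ≠ 1 → h ≠ 1 → g * h = 1 := by decide
    by_cases hg : g = 1
    · simp [hg]
    · by_cases hh : h = 1
      · simp [hh]
      · simp [hg, hh, key g h hg hh, hsq]

end NCTorus

/-! ### Crossed products of C⋆-algebras by finite groups -/

section CrossedProduct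

set_option linter.unusedSectionVars false

variable {G A : Type*} [Group G] [Fintype G] [DecidableEq G] [CStarAlgebra A]

/-- The crossed product `A ⋊ G` of a C⋆-algebra by an action `α` of a finite group: the functions
`Ψ : G → A`, thought of as `∑ g, Ψ g * δ_g` with `δ_g * a = α_g a * δ_g`. -/
def CrossedProduct (_α : G →* (A ≃⋆ₐ[ℂ] A)) : Type _ := G → A

namespace CrossedProduct

variable {α : G →* (A ≃⋆ₐ[ℂ] A)}

instance : AddCommGroup (CrossedProduct α) := inferInstanceAs (AddCommGroup (G → A))

instance : Module ℂ (CrossedProduct α) := inferInstanceAs (Module ℂ (G → A))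

/-- The convolution product `(ΛΨ)(g) = ∑ h, Λ(h) α_h(Ψ(h⁻¹ g))`. -/
instance : Mul (CrossedProduct α) := ⟨fun Λ Ψ g => ∑ h, Λ h * α h (Ψ (h⁻¹ * g))⟩

instance : One (CrossedProduct α) := ⟨fun g => if g = 1 then 1 else 0⟩

/-- The involution `Ψ⋆(g) = α_g(Ψ(g⁻¹)⋆)`. -/
instance : Star (CrossedProduct α) := ⟨fun Ψ g => α g (star (Ψ g⁻¹))⟩

@[ext] theorem ext {Λ Ψ : CrossedProduct α} (h : ∀ g, Λ g = Ψ g) : Λ = Ψ := funext h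

theorem add_apply (Λ Ψ : CrossedProduct α) (g : G) : (Λ + Ψ) g = Λ g + Ψ g := rfl

theorem zero_apply (g : G) : (0 : CrossedProduct α) g = 0 := rfl

theorem smul_apply (c : ℂ) (Ψ : CrossedProduct α) (g : G) : (c • Ψ) g = c • Ψ g := rfl

theorem mul_apply (Λ Ψ : CrossedProduct α) (g : G) :
    (Λ * Ψ) g = ∑ h, Λ h * α h (Ψ (h⁻¹ * g)) := rfl

theorem one_apply (g : G) : (1 : CrossedProduct α) g = if g = 1 then 1 else 0 := rfl

theorem star_apply (Ψ : CrossedProduct α) (g : G) : (star Ψ) g = α g (star (Ψ g⁻¹)) := rfl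

theorem action_action (g h : G) (a : A) : α g (α h a) = α (g * h) a := by
  rw [map_mul]; rfl

theorem action_one (a : A) : α 1 a = a := by rw [map_one]; rfl

/-- The regular representation of `A ⋊ G` by `G × G` matrices over `A`. -/
def regular (Ψ : CrossedProduct α) : CStarMatrix G G A :=
  CStarMatrix.ofMatrix fun s t => α s⁻¹ (Ψ (s * t⁻¹))

theorem regular_apply (Ψ : CrossedProduct α) (s t : G) :
    regular Ψ s t = α s⁻¹ (Ψ (s * t⁻¹)) := rfl

theorem regular_injective : Function.Injective (regular (α := α)) := by
  intro Λ Ψ h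
  ext g
  have := congrFun (congrFun h g) 1
  simpa [regular_apply] using this

theorem regular_add (Λ Ψ : CrossedProduct α) : regular (Λ + Ψ) = regular Λ + regular Ψ := by
  ext s t; simp [regular_apply, add_apply]

theorem regular_zero : regular (0 : CrossedProduct α) = 0 := by
  ext s t; simp [regular_apply, zero_apply]

theorem regular_smul (c : ℂ) (Ψ : CrossedProduct α) : regular (c • Ψ) = c • regular Ψ := by
  ext s t; simp [regular_apply, smul_apply]

theorem regular_one : regular (1 : CrossedProduct α) = 1 := by
  ext s t
  rw [regular_apply, one_apply, CStarMatrix.one_apply]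
  by_cases h : s = t
  · simp [h]
  · simp [h, mul_inv_eq_one]

theorem regular_mul (Λ Ψ : CrossedProduct α) : regular (Λ * Ψ) = regular Λ * regular Ψ := by
  ext s t
  rw [CStarMatrix.mul_apply, regular_apply, mul_apply, map_sum]
  refine Fintype.sum_equiv ((Equiv.inv G).trans (Equiv.mulRight s)) _ _ fun h => ?_
  simp [regular_apply, mul_assoc]

theorem regular_star (Ψ : CrossedProduct α) : regular (star Ψ) = star (regular Ψ) := by
  ext s t
  rw [CStarMatrix.star_apply, regular_apply, regular_apply, star_apply, action_action,
    ← map_star]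
  simp

instance : Ring (CrossedProduct α) where
  __ := (inferInstance : AddCommGroup (CrossedProduct α))
  mul_assoc a b c := regular_injective (by simp only [regular_mul, mul_assoc])
  one_mul a := regular_injective (by simp only [regular_mul, regular_one, one_mul])
  mul_one a := regular_injective (by simp only [regular_mul, regular_one, mul_one])
  left_distrib a b c := regular_injective (by simp only [regular_mul, regular_add, mul_add])
  right_distrib a b c := regular_injective (by simp only [regular_mul, regular_add, add_mul])
  zero_mul a := regular_injective (by simp only [regular_mul, regular_zero, zero_mul])
  mul_zero a := regular_injective (by simp only [regular_mul, regular_zero, mul_zero])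

instance : StarRing (CrossedProduct α) where
  star_involutive a := regular_injective (by simp only [regular_star, star_star])
  star_mul a b := regular_injective (by simp only [regular_star, regular_mul, star_mul])
  star_add a b := regular_injective (by simp only [regular_star, regular_add, star_add])

instance : Algebra ℂ (CrossedProduct α) :=
  Algebra.ofModule
    (fun c a b => regular_injective (by simp only [regular_mul, regular_smul, smul_mul_assoc]))
    (fun c a b => regular_injective (by simp only [regular_mul, regular_smul, mul_smul_comm]))

/-- The regular representation as a homomorphism of complex algebras. -/
def regularHom : CrossedProduct α →ₐ[ℂ] CStarMatrix G G A :=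
  AlgHom.ofLinearMap
    { toFun := regular, map_add' := regular_add, map_smul' := regular_smul }
    regular_one regular_mul

theorem regular_range :
    Set.range (regular (α := α)) = {M | ∀ s t, M s t = α t⁻¹ (M (s * t⁻¹) 1)} := by
  ext M
  constructor
  · rintro ⟨Ψ, rfl⟩ s t
    rw [regular_apply, regular_apply, action_action]
    simp only [inv_one, mul_one, mul_inv_rev, inv_inv, inv_mul_cancel_left]
  · intro hM
    let Ψ : CrossedProduct α := fun g => α g (M g 1)
    refine ⟨Ψ, ?_⟩
    ext s t
    have h : regular Ψ s t = α s⁻¹ (α (s * t⁻¹) (M (s * t⁻¹) 1)) := rfl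
    rw [hM s t, h, action_action, inv_mul_cancel_left]

section Norm

/-- The norm on `A ⋊ G` for which the regular representation in the C⋆-algebra of `G × G` matrices
over `A` is isometric. -/
instance : NormedRing (CrossedProduct α) :=
  letI := CStarAlgebra.spectralOrder A
  letI := CStarAlgebra.spectralOrderedRing A
  NormedRing.induced (CrossedProduct α) (CStarMatrix G G A) regularHom regular_injective

theorem norm_def (Ψ : CrossedProduct α) :
    letI := CStarAlgebra.spectralOrder A
    letI := CStarAlgebra.spectralOrderedRing A
    ‖Ψ‖ = ‖regular Ψ‖ := rfl

instance : NormedAlgebra ℂ (CrossedProduct α) :=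
  letI := CStarAlgebra.spectralOrder A
  letI := CStarAlgebra.spectralOrderedRing A
  NormedAlgebra.induced ℂ (CrossedProduct α) (CStarMatrix G G A) regularHom

instance : StarModule ℂ (CrossedProduct α) where
  star_smul c a := regular_injective (by simp only [regular_star, regular_smul, star_smul])

instance : CStarRing (CrossedProduct α) where
  norm_mul_self_le a := by
    let _ := CStarAlgebra.spectralOrder A
    let _ := CStarAlgebra.spectralOrderedRing A
    rw [norm_def, norm_def, regular_mul, regular_star]
    exact CStarRing.norm_mul_self_le _

instance : CompleteSpace (CrossedProduct α) := by
  let _ := CStarAlgebra.spectralOrder A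
  let _ := CStarAlgebra.spectralOrderedRing A
  have hiso : Isometry (regular (α := α)) :=
    AddMonoidHomClass.isometry_of_norm (regularHom (α := α)) fun _ => rfl
  rw [completeSpace_iff_isComplete_range hiso.isUniformInducing, regular_range]
  have hα : ∀ g : G, Continuous (α g) := fun g => map_continuous (α g)
  have hentry : ∀ s t : G, Continuous fun M : CStarMatrix G G A => M s t := fun s t =>
    (continuous_apply t).comp (continuous_apply s)
  refine IsClosed.isComplete ?_
  simp only [Set.ofPred_forall]
  exact isClosed_iInter fun s => isClosed_iInter fun t =>
    isClosed_eq (hentry s t) ((hα _).comp (hentry _ _))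

/-- The crossed product is a C⋆-algebra. Since the C⋆-norm of a C⋆-algebra is determined by its
⋆-algebra structure, its norm is also the one that comes from all covariant representations. -/
instance : CStarAlgebra (CrossedProduct α) where

end Norm

end CrossedProduct

end CrossedProduct

/-! ### Morita equivalence of C⋆-algebras -/

section Morita

universe u

/-- An imprimitivity bimodule for two unital C⋆-algebras `A` and `B`: an `A`-`B`-bimodule `E` that
is a full left Hilbert `A`-module and a full right Hilbert `B`-module, such that each algebra acts
by adjointable operators for the inner product of the other and
`⟨x, y⟩_A · z = x · ⟨y, z⟩_B`. The two inner products induce the same norm, for which `E` is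
complete. Right `B`-modules are modules over `Bᵐᵒᵖ`. -/
structure ImprimitivityBimodule (A B E : Type*) [CStarAlgebra A] [CStarAlgebra B]
    [NormedAddCommGroup E] [NormedSpace ℂ E] [CompleteSpace E]
    [Module A E] [Module Bᵐᵒᵖ E] [SMulCommClass A Bᵐᵒᵖ E]
    [IsScalarTower ℂ A E] [IsScalarTower ℂ Bᵐᵒᵖ E] where
  /-- The `A`-valued inner product, linear in the first variable. -/
  innerL : E → E → A
  /-- The `B`-valued inner product, linear in the second variable. -/
  innerR : E → E → B
  innerL_add_left : ∀ x y z, innerL (x + y) z = innerL x z + innerL y z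
  innerL_smul_left : ∀ (a : A) x y, innerL (a • x) y = a * innerL x y
  star_innerL : ∀ x y, star (innerL x y) = innerL y x
  innerL_self_nonneg : ∀ x, ∃ a : A, innerL x x = star a * a
  innerL_self_eq_zero : ∀ x, innerL x x = 0 → x = 0
  norm_sq_eq_innerL : ∀ x, ‖x‖ ^ 2 = ‖innerL x x‖
  dense_innerL : Dense (Submodule.span ℂ {a | ∃ x y, innerL x y = a} : Set A)
  innerR_add_right : ∀ x y z, innerR x (y + z) = innerR x y + innerR x z
  innerR_smul_right : ∀ (b : B) x y, innerR x (MulOpposite.op b • y) = innerR x y * b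
  star_innerR : ∀ x y, star (innerR x y) = innerR y x
  innerR_self_nonneg : ∀ x, ∃ b : B, innerR x x = star b * b
  innerR_self_eq_zero : ∀ x, innerR x x = 0 → x = 0
  norm_sq_eq_innerR : ∀ x, ‖x‖ ^ 2 = ‖innerR x x‖
  dense_innerR : Dense (Submodule.span ℂ {b | ∃ x y, innerR x y = b} : Set B)
  innerR_smul_left : ∀ (a : A) x y, innerR (a • x) y = innerR x (star a • y)
  innerL_smul_op_left : ∀ (b : B) x y,
    innerL (MulOpposite.op b • x) y = innerL x (MulOpposite.op (star b) • y)
  innerL_smul_eq_smul_innerR : ∀ x y z, innerL x y • z = MulOpposite.op (innerR y z) • x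

/-- Two unital C⋆-algebras are (strongly) Morita equivalent if there is an imprimitivity bimodule
for them. -/
def MoritaEquivalent (A B : Type u) [CStarAlgebra A] [CStarAlgebra B] : Prop :=
  ∃ (E : Type u) (_ : NormedAddCommGroup E) (_ : NormedSpace ℂ E) (_ : CompleteSpace E)
    (_ : Module A E) (_ : Module Bᵐᵒᵖ E) (_ : SMulCommClass A Bᵐᵒᵖ E)
    (_ : IsScalarTower ℂ A E) (_ : IsScalarTower ℂ Bᵐᵒᵖ E),
    Nonempty (ImprimitivityBimodule A B E)

end Morita

end

/-!
Let `σ` be the flip, `B` the crossed product, `δ` the unitary in `B` that implements `σ`, and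
`e = (1 + δ) / 2` the averaging projection. The map `a ↦ a e` identifies the fixed-point algebra with
the corner `e B e`, so `e B` is an imprimitivity bimodule as soon as `e` is full, that is, as soon
as `1` is a combination of elements `x e y` (`MoritaEquivalent.of_fullCorner`,
`CrossedProduct.moritaEquivalent_of_full`). The bimodule carries the norm of `B`, so that its
completeness is that of a closed subspace.

For fullness, take the unitaries `U = U_p` and `V = U_q` of the noncommutative torus for two basis
vectors `p` and `q` of `ℤⁿ`. They satisfy `V U V⁻¹ = z U` for a scalar `z = exp (-2 π i θ)`, where
`θ` is an entry of `Θ`, and the flip inverts both of them. The ideal of `B` that `e` generates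
contains `x (y - σ(y))` up to multiplication by `δ`, hence `U - U⁻¹` and its conjugate
`z U - z⁻¹ U⁻¹` by `V`, hence `(z - z⁻¹) U`. This is invertible unless `2 θ` is an integer
(`CrossedProduct.one_mem_span_mulAverage`, which makes the combination explicit).
-/

noncomputable section

/-! ### Full corners of C⋆-algebras -/

section FullCorner

universe u

variable {C B : Type u} [CStarAlgebra C] [CStarAlgebra B]

/-- The right ideal `φ(1) B` of `B`, for a homomorphism `φ : C → B` that need not preserve `1`. -/
def cornerIdeal (φ : C →⋆ₙₐ[ℂ] B) : Submodule ℂ B where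
  carrier := {x | φ 1 * x = x}
  add_mem' {x y} (hx : φ 1 * x = x) (hy : φ 1 * y = y) := by simp [mul_add, hx, hy]
  zero_mem' := by simp
  smul_mem' c x (hx : φ 1 * x = x) := by simp [hx]

theorem mem_cornerIdeal {φ : C →⋆ₙₐ[ℂ] B} {x : B} : x ∈ cornerIdeal φ ↔ φ 1 * x = x := Iff.rfl

theorem map_mul_mem_cornerIdeal (φ : C →⋆ₙₐ[ℂ] B) (c : C) (x : B) :
    φ c * x ∈ cornerIdeal φ := by
  rw [mem_cornerIdeal, ← mul_assoc, ← map_mul, one_mul]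

theorem mul_mem_cornerIdeal {φ : C →⋆ₙₐ[ℂ] B} {x : B} (hx : x ∈ cornerIdeal φ) (b : B) :
    x * b ∈ cornerIdeal φ := by
  rw [mem_cornerIdeal, ← mul_assoc, mem_cornerIdeal.1 hx]

theorem isClosed_cornerIdeal (φ : C →⋆ₙₐ[ℂ] B) : IsClosed (cornerIdeal φ : Set B) :=
  isClosed_eq (continuous_const.mul continuous_id) continuous_id

namespace cornerIdeal

variable (φ : C →⋆ₙₐ[ℂ] B)

instance : CompleteSpace (cornerIdeal φ) :=
  (isClosed_cornerIdeal φ).completeSpace_coe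

/-- `C` acts on `φ(1) B` through `φ` and left multiplication. -/
abbrev leftModule : Module C (cornerIdeal φ) where
  smul c x := ⟨φ c * x, map_mul_mem_cornerIdeal φ c x⟩
  one_smul x := Subtype.ext x.2
  mul_smul c d x := Subtype.ext <| by
    change φ (c * d) * (x : B) = φ c * (φ d * x)
    rw [map_mul, mul_assoc]
  smul_zero c := Subtype.ext (mul_zero (φ c))
  smul_add c x y := Subtype.ext (mul_add (φ c) x y)
  add_smul c d x := Subtype.ext <| by
    change φ (c + d) * (x : B) = φ c * x + φ d * x
    rw [map_add, add_mul]
  zero_smul x := Subtype.ext <| by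
    change φ 0 * (x : B) = 0
    rw [map_zero, zero_mul]

/-- `B` acts on `φ(1) B` by right multiplication. -/
abbrev rightModule : Module Bᵐᵒᵖ (cornerIdeal φ) where
  smul b x := ⟨x * b.unop, mul_mem_cornerIdeal x.2 _⟩
  one_smul x := Subtype.ext (mul_one (x : B))
  mul_smul b c x := Subtype.ext (mul_assoc (x : B) c.unop b.unop).symm
  smul_zero b := Subtype.ext (zero_mul b.unop)
  smul_add b x y := Subtype.ext (add_mul (x : B) y b.unop)
  add_smul b c x := Subtype.ext (mul_add (x : B) b.unop c.unop)
  zero_smul x := Subtype.ext (mul_zero (x : B))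

end cornerIdeal

/-- A left unit of a positive element is a left unit of its square root. In particular, the corner
of `B` at a projection contains the square roots of its positive elements. -/
theorem mul_sqrt_eq_of_mul_eq [PartialOrder B] [StarOrderedRing B] {p a : B} (ha : 0 ≤ a)
    (hpa : p * a = a) : p * CFC.sqrt a = CFC.sqrt a := by
  have hs : star (CFC.sqrt a) = CFC.sqrt a := (CFC.sqrt_nonneg a).isSelfAdjoint
  -- `(p s - s)(p s - s)⋆ = (p - 1) s² (p - 1)⋆ = 0` for the square root `s` of `a`.
  have h : (p * CFC.sqrt a - CFC.sqrt a) * star (p * CFC.sqrt a - CFC.sqrt a) = 0 := by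
    calc _ = (p * (CFC.sqrt a * CFC.sqrt a) - CFC.sqrt a * CFC.sqrt a) * star (p - 1) := by
          simp only [star_sub, star_mul, hs, star_one]; noncomm_ring
      _ = 0 := by rw [CFC.sqrt_mul_sqrt_self a, hpa, sub_self, zero_mul]
  exact sub_eq_zero.1 (CStarRing.mul_star_self_eq_zero_iff _ |>.1 h)

/-- A C⋆-algebra that is embedded as a full corner `p B p` in `B`, where `p = φ(1)`, is Morita
equivalent to `B`. The bimodule is `p B` with the inner products `x y⋆` and `x⋆ y`. -/
theorem MoritaEquivalent.of_fullCorner (φ : C →⋆ₙₐ[ℂ] B) (hφ : Function.Injective φ)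
    (hcorner : ∀ b : B, φ 1 * b * φ 1 ∈ Set.range φ)
    (hfull : (1 : B) ∈ Submodule.span ℂ {b | ∃ x y, x * φ 1 * y = b}) :
    MoritaEquivalent C B := by
  have hstar : star (φ 1) = φ 1 := by rw [← map_star, star_one]
  have hidem : φ 1 * φ 1 = φ 1 := by rw [← map_mul, one_mul]
  have hmem : ∀ x : cornerIdeal φ, φ 1 * (x : B) = x := fun x => x.2
  have hmem' : ∀ x : cornerIdeal φ, star (x : B) * φ 1 = star (x : B) := fun x => by
    rw [← hstar, ← star_mul, hmem]
  have hrange : ∀ x y : cornerIdeal φ, ∃ c, φ c = x * star (y : B) := fun x y => by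
    have := hcorner (x * star (y : B))
    rwa [← mul_assoc, hmem, mul_assoc, hmem'] at this
  choose L hL using hrange
  let _ := cornerIdeal.leftModule φ
  let _ := cornerIdeal.rightModule φ
  have hl : ∀ (c : C) (x : cornerIdeal φ), ((c • x : cornerIdeal φ) : B) = φ c * x :=
    fun _ _ => rfl
  have hr : ∀ (b : B) (x : cornerIdeal φ),
      ((MulOpposite.op b • x : cornerIdeal φ) : B) = x * b := fun _ _ => rfl
  have hcomm : SMulCommClass C Bᵐᵒᵖ (cornerIdeal φ) :=
    ⟨fun c b x => Subtype.ext (mul_assoc (φ c) (x : B) b.unop).symm⟩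
  have htower : IsScalarTower ℂ C (cornerIdeal φ) := ⟨fun z c x => Subtype.ext <| by
    change φ (z • c) * (x : B) = z • (φ c * x)
    rw [map_smul, smul_mul_assoc]⟩
  have htower' : IsScalarTower ℂ Bᵐᵒᵖ (cornerIdeal φ) :=
    ⟨fun z b x => Subtype.ext (mul_smul_comm z (x : B) b.unop)⟩
  refine ⟨cornerIdeal φ, inferInstance, inferInstance, inferInstance,
    inferInstance, inferInstance, hcomm, htower, htower', ⟨?_⟩⟩
  exact
  { innerL := L
    innerR := fun x y => star (x : B) * y
    innerL_add_left := fun x y z => hφ <| by simp [hL, add_mul]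
    innerL_smul_left := fun a x y => hφ <| by simp [hL, hl, mul_assoc]
    star_innerL := fun x y => hφ <| by simp [hL, map_star]
    innerL_self_nonneg := fun x => by
      let _ := CStarAlgebra.spectralOrder B
      let _ := CStarAlgebra.spectralOrderedRing B
      have hpos : 0 ≤ (x : B) * star (x : B) := mul_star_self_nonneg _
      have hs := (CFC.sqrt_nonneg ((x : B) * star (x : B))).isSelfAdjoint.star_eq
      have hp := mul_sqrt_eq_of_mul_eq hpos (p := φ 1) (by rw [← mul_assoc, hmem])
      have hp' := congrArg star hp
      rw [star_mul, hs, hstar] at hp'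
      obtain ⟨d, hd⟩ := hcorner (CFC.sqrt ((x : B) * star (x : B)))
      rw [hp, hp'] at hd
      refine ⟨d, hφ ?_⟩
      rw [hL, map_mul, map_star, hd, hs, CFC.sqrt_mul_sqrt_self _ hpos]
    innerL_self_eq_zero := fun x hx => Subtype.ext <| by
      have h := hL x x
      rw [hx, map_zero] at h
      exact (CStarRing.mul_star_self_eq_zero_iff _).1 h.symm
    norm_sq_eq_innerL := fun x => by
      rw [← NonUnitalStarAlgHom.norm_map φ hφ, hL, CStarRing.norm_self_mul_star, sq,
        Submodule.coe_norm]
    dense_innerL := by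
      have htop : Submodule.span ℂ {a | ∃ x y, L x y = a} = ⊤ := by
        refine eq_top_iff.2 fun c _ => Submodule.subset_span ?_
        refine ⟨⟨φ c * 1, map_mul_mem_cornerIdeal φ c 1⟩, ⟨φ 1, hidem⟩, hφ ?_⟩
        rw [hL, hstar]
        change φ c * 1 * φ 1 = φ c
        rw [mul_one, ← map_mul, mul_one]
      rw [htop]
      exact dense_univ
    innerR_add_right := fun x y z => mul_add _ _ _
    innerR_smul_right := fun b x y => (mul_assoc _ _ _).symm
    star_innerR := fun x y => by simp
    innerR_self_nonneg := fun x => ⟨x, rfl⟩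
    innerR_self_eq_zero := fun x hx =>
      Subtype.ext ((CStarRing.star_mul_self_eq_zero_iff _).1 hx)
    norm_sq_eq_innerR := fun x => by
      rw [CStarRing.norm_star_mul_self, sq, Submodule.coe_norm]
    dense_innerR := by
      have htop : Submodule.span ℂ
          {b | ∃ x y : cornerIdeal φ, star (x : B) * y = b} = ⊤ := by
        refine eq_top_iff.2 fun b _ => ?_
        have key : ∀ a ∈ Submodule.span ℂ {b | ∃ x y, x * φ 1 * y = b}, a * b ∈
            Submodule.span ℂ {b | ∃ x y : cornerIdeal φ, star (x : B) * y = b} := by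
          intro a ha
          induction ha using Submodule.span_induction with
          | mem a ha =>
            obtain ⟨x, y, rfl⟩ := ha
            refine Submodule.subset_span
              ⟨⟨_, map_mul_mem_cornerIdeal φ 1 (star x)⟩, ⟨_, map_mul_mem_cornerIdeal φ 1 (y * b)⟩,
                ?_⟩
            change star (φ 1 * star x) * (φ 1 * (y * b)) = x * φ 1 * y * b
            rw [star_mul, star_star, hstar, mul_assoc x, ← mul_assoc (φ 1), hidem]
            simp only [mul_assoc]
          | zero => simp
          | add x y _ _ hx hy => rw [add_mul]; exact add_mem hx hy
          | smul c x _ hx => rw [smul_mul_assoc]; exact Submodule.smul_mem _ _ hx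
        simpa using key 1 hfull
      rw [htop]
      exact dense_univ
    innerR_smul_left := fun a x y => by
      rw [hl, hl, star_mul, map_star, mul_assoc]
    innerL_smul_op_left := fun b x y => hφ <| by
      rw [hL, hL, hr, hr, star_mul, star_star, mul_assoc]
    innerL_smul_eq_smul_innerR := fun x y z => Subtype.ext <| by
      rw [hl, hr, hL, mul_assoc] }

end FullCorner

/-! ### Crossed products by `ℤ/2` and fixed-point algebras -/

namespace CrossedProduct

/-- The non-trivial element of `ℤ/2`. -/
abbrev gen : Multiplicative (ZMod 2) := Multiplicative.ofAdd 1

theorem sum_eq_add_gen {M : Type*} [AddCommMonoid M] (f : Multiplicative (ZMod 2) → M) :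
    ∑ g, f g = f 1 + f gen :=
  Fin.sum_univ_two f

theorem eq_one_or_eq_gen (g : Multiplicative (ZMod 2)) : g = 1 ∨ g = gen := by
  revert g; decide

theorem gen_ne_one : gen ≠ 1 := by decide

theorem gen_inv : gen⁻¹ = gen := by decide

theorem gen_mul_gen : gen * gen = 1 := by decide

universe u

variable {A C : Type u} [CStarAlgebra A] [CStarAlgebra C]
  {α : Multiplicative (ZMod 2) →* (A ≃⋆ₐ[ℂ] A)}

theorem gen_action_gen_action (a : A) : α gen (α gen a) = a := by
  rw [action_action, gen_mul_gen, action_one]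

theorem action_eq_of_gen_action_eq {a : A} (ha : α gen a = a) (g : Multiplicative (ZMod 2)) :
    α g a = a := by
  rcases eq_one_or_eq_gen g with rfl | rfl
  · exact action_one a
  · exact ha

theorem mul_apply_one (Λ Ψ : CrossedProduct α) :
    (Λ * Ψ) 1 = Λ 1 * Ψ 1 + Λ gen * α gen (Ψ gen) := by
  rw [mul_apply, sum_eq_add_gen, action_one, inv_one, mul_one, gen_inv, mul_one]

theorem mul_apply_gen (Λ Ψ : CrossedProduct α) :
    (Λ * Ψ) gen = Λ 1 * Ψ gen + Λ gen * α gen (Ψ 1) := by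
  rw [mul_apply, sum_eq_add_gen, action_one, inv_one, one_mul, gen_inv, gen_mul_gen]

theorem ext_gen {Λ Ψ : CrossedProduct α} (h1 : Λ 1 = Ψ 1) (h2 : Λ gen = Ψ gen) : Λ = Ψ := by
  ext1 g
  rcases eq_one_or_eq_gen g with rfl | rfl
  · exact h1
  · exact h2

/-- The element `a p` of `A ⋊ ℤ/2`, for `a` in `A` and the averaging projection `p = (1 + δ) / 2`,
where `δ` implements the action of the generator. -/
def mulAverage (α : Multiplicative (ZMod 2) →* (A ≃⋆ₐ[ℂ] A)) (a : A) : CrossedProduct α :=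
  fun _ => (2⁻¹ : ℂ) • a

theorem mulAverage_apply (a : A) (g : Multiplicative (ZMod 2)) :
    mulAverage α a g = (2⁻¹ : ℂ) • a := rfl

theorem mulAverage_mul {a b : A} (hb : α gen b = b) :
    mulAverage α (a * b) = mulAverage α a * mulAverage α b := by
  have h : (2⁻¹ : ℂ) • (a * b) = (2⁻¹ : ℂ) • a * (2⁻¹ : ℂ) • b + (2⁻¹ : ℂ) • a * (2⁻¹ : ℂ) • b := by
    rw [smul_mul_smul_comm, ← add_smul]
    norm_num
  refine ext_gen ?_ ?_
  · simp only [mul_apply_one, mulAverage_apply, map_smul, hb]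
    exact h
  · simp only [mul_apply_gen, mulAverage_apply, map_smul, hb]
    exact h

theorem mulAverage_star {a : A} (ha : α gen a = a) :
    mulAverage α (star a) = star (mulAverage α a) := by
  ext g
  rw [star_apply, mulAverage_apply, mulAverage_apply, star_smul, map_smul, map_star,
    action_eq_of_gen_action_eq ha]
  simp

/-- The embedding `c ↦ ι(c) p` of an algebra `C` of fixed points into `A ⋊ ℤ/2`, where `p` is the
averaging projection. -/
def averageEmbedding (ι : C →⋆ₐ[ℂ] A) (hι : ∀ c, α gen (ι c) = ι c) :
    C →⋆ₙₐ[ℂ] CrossedProduct α where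
  toFun c := mulAverage α (ι c)
  map_smul' z c := by
    ext g
    rw [map_smul, mulAverage_apply]
    exact smul_comm (2⁻¹ : ℂ) z (ι c)
  map_zero' := by
    ext g
    rw [map_zero, mulAverage_apply, smul_zero, zero_apply]
  map_add' c d := by
    ext g
    rw [map_add, add_apply, mulAverage_apply, mulAverage_apply, mulAverage_apply, smul_add]
  map_mul' c d := by rw [map_mul, mulAverage_mul (hι d)]
  map_star' c := by rw [map_star, mulAverage_star (hι c)]

theorem averageEmbedding_apply (ι : C →⋆ₐ[ℂ] A) (hι : ∀ c, α gen (ι c) = ι c) (c : C) :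
    averageEmbedding ι hι c = mulAverage α (ι c) := rfl

theorem averageEmbedding_injective {ι : C →⋆ₐ[ℂ] A} (hι : ∀ c, α gen (ι c) = ι c)
    (hinj : Function.Injective ι) : Function.Injective (averageEmbedding ι hι) := fun c d h => by
  have h1 := congrFun h 1
  rw [averageEmbedding_apply, averageEmbedding_apply, mulAverage_apply, mulAverage_apply] at h1
  exact hinj (smul_right_injective A (inv_ne_zero two_ne_zero) h1)

theorem mulAverage_one_mul_mul_mulAverage_one (b : CrossedProduct α) :
    mulAverage α 1 * b * mulAverage α 1 =
      mulAverage α ((2⁻¹ : ℂ) • (b 1 + b gen + α gen (b 1) + α gen (b gen))) := by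
  refine ext_gen ?_ ?_
  all_goals
    simp only [mul_apply_one, mul_apply_gen, mulAverage_apply, map_smul, map_one, smul_mul_assoc,
      mul_smul_comm, one_mul, mul_one, smul_add]
    abel

/-- The copy of `A` in `A ⋊ ℤ/2`. -/
def inclusion (α : Multiplicative (ZMod 2) →* (A ≃⋆ₐ[ℂ] A)) (a : A) : CrossedProduct α :=
  fun g => if g = 1 then a else 0

theorem inclusion_one (a : A) : inclusion α a 1 = a := if_pos rfl

theorem inclusion_gen (a : A) : inclusion α a gen = 0 := if_neg gen_ne_one

theorem inclusion_mul_average_mul_inclusion_one (a b : A) :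
    (inclusion α a * mulAverage α 1 * inclusion α b) 1 = (2⁻¹ : ℂ) • (a * b) := by
  simp [mul_apply_one, mul_apply_gen, inclusion_one, inclusion_gen, mulAverage_apply]

theorem inclusion_mul_average_mul_inclusion_gen (a b : A) :
    (inclusion α a * mulAverage α 1 * inclusion α b) gen = (2⁻¹ : ℂ) • (a * α gen b) := by
  simp [mul_apply_one, mul_apply_gen, inclusion_one, inclusion_gen, mulAverage_apply]

/-- The averaging projection `p` is full if the action inverts two invertible elements `U` and `V`
with `V U V⁻¹ = z U` for a scalar `z` other than `1` and `-1`. Put `[x, y] = x p y`, which is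
`(x y + x σ(y) δ) / 2` for the action `σ` of the generator and its implementing unitary `δ`. Then
`[V, U⁻¹ V⁻¹] - [V U, V⁻¹] - z⁻¹ ([1, U⁻¹] - [U, 1]) = ((z⁻¹ - z) / 2) U`,
because `σ(U⁻¹) = U` and `σ(V⁻¹) = V` make the coefficients of `δ` cancel. -/
theorem one_mem_span_mulAverage {U U' V V' : A} {z : ℂ} (hz : z⁻¹ - z ≠ 0) (hU : U' * U = 1)
    (hconj : V * U * V' = z • U) (hconj' : V * U' * V' = z⁻¹ • U')
    (hσU : α gen U' = U) (hσV : α gen V' = V) :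
    (1 : CrossedProduct α) ∈ Submodule.span ℂ {b | ∃ x y, x * mulAverage α 1 * y = b} := by
  let P (x y : A) : CrossedProduct α := inclusion α x * mulAverage α 1 * inclusion α y
  have hP : ∀ x y, P x y ∈ Submodule.span ℂ {b | ∃ x y, x * mulAverage α 1 * y = b} :=
    fun x y => Submodule.subset_span ⟨_, _, rfl⟩
  have hP1 : ∀ x y, P x y 1 = (2⁻¹ : ℂ) • (x * y) := inclusion_mul_average_mul_inclusion_one
  have hPg : ∀ x y, P x y gen = (2⁻¹ : ℂ) • (x * α gen y) :=
    inclusion_mul_average_mul_inclusion_gen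
  have h1 : U' * V * (U' * V') = z⁻¹ • (U' * U') := by
    rw [← mul_smul_comm, ← hconj']
    simp only [mul_assoc]
  have h2 : U' * (V * U) * V' = z • (1 : A) := by
    rw [mul_assoc, hconj, mul_smul_comm, hU]
  have h3 : U' * (V * U) * V = U' * V * (U * V) := by simp only [mul_assoc]
  have key : (1 : CrossedProduct α) = (2 * (z⁻¹ - z)⁻¹) •
      (P (U' * V) (U' * V') + (-1 : ℂ) • P (U' * (V * U)) V' +
        (-z⁻¹) • (P U' U' + (-1 : ℂ) • P 1 1)) := by
    refine ext_gen ?_ ?_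
    · simp only [smul_apply, add_apply, hP1]
      rw [one_apply, if_pos rfl, h1, h2, mul_one]
      calc (1 : A) = ((z⁻¹ - z)⁻¹ * (z⁻¹ - z)) • (1 : A) := by rw [inv_mul_cancel₀ hz, one_smul]
        _ = _ := by module
    · simp only [smul_apply, add_apply, hPg]
      rw [one_apply, if_neg gen_ne_one, map_mul, hσU, hσV, map_one, h3, hU, mul_one]
      module
  rw [key]
  exact Submodule.smul_mem _ _ (add_mem (add_mem (hP _ _) (Submodule.smul_mem _ _ (hP _ _)))
    (Submodule.smul_mem _ _ (add_mem (hP _ _) (Submodule.smul_mem _ _ (hP _ _)))))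

/-- If the averaging projection is full, then the fixed-point algebra, given as the image of an
embedding `ι`, is Morita equivalent to the crossed product. -/
theorem moritaEquivalent_of_full (ι : C →⋆ₐ[ℂ] A) (hinj : Function.Injective ι)
    (hι : ∀ a, a ∈ Set.range ι ↔ α gen a = a)
    (hfull : (1 : CrossedProduct α) ∈
      Submodule.span ℂ {b | ∃ x y, x * mulAverage α 1 * y = b}) :
    MoritaEquivalent C (CrossedProduct α) := by
  have hfix : ∀ c, α gen (ι c) = ι c := fun c => (hι _).1 ⟨c, rfl⟩
  have hone : averageEmbedding ι hfix 1 = mulAverage α 1 := by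
    rw [averageEmbedding_apply, map_one]
  refine MoritaEquivalent.of_fullCorner (averageEmbedding ι hfix)
    (averageEmbedding_injective hfix hinj) (fun b => ?_) (by rwa [hone])
  obtain ⟨c, hc⟩ := (hι ((2⁻¹ : ℂ) • (b 1 + b gen + α gen (b 1) + α gen (b gen)))).2 <| by
    simp only [map_smul, map_add, gen_action_gen_action]
    congr 1
    abel
  exact ⟨c, by rw [hone, mulAverage_one_mul_mul_mulAverage_one, averageEmbedding_apply, hc]⟩

end CrossedProduct

/-! ### The unitary generators of a noncommutative torus -/

namespace NCTorus

variable {n : ℕ}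

theorem cocycle_add_left (Θ : Matrix (Fin n) (Fin n) ℝ) (p q r : Fin n → ℤ) :
    cocycle Θ (p + q) r = cocycle Θ p r * cocycle Θ q r := by
  rw [cocycle, cocycle, cocycle, ← Complex.exp_add]
  congr 1
  simp only [Pi.add_apply, Int.cast_add, mul_add, add_mul, Finset.sum_add_distrib,
    Complex.ofReal_add]
  ring

theorem cocycle_add_right (Θ : Matrix (Fin n) (Fin n) ℝ) (p q r : Fin n → ℤ) :
    cocycle Θ p (q + r) = cocycle Θ p q * cocycle Θ p r := by
  rw [cocycle, cocycle, cocycle, ← Complex.exp_add]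
  congr 1
  simp only [Pi.add_apply, Int.cast_add, mul_add, Finset.sum_add_distrib, Complex.ofReal_add]
  ring

theorem cocycle_neg_left (Θ : Matrix (Fin n) (Fin n) ℝ) (p q : Fin n → ℤ) :
    cocycle Θ (-p) q = (cocycle Θ p q)⁻¹ := by
  rw [cocycle, cocycle, ← Complex.exp_neg]
  simp

theorem cocycle_neg_right (Θ : Matrix (Fin n) (Fin n) ℝ) (p q : Fin n → ℤ) :
    cocycle Θ p (-q) = (cocycle Θ p q)⁻¹ := by
  rw [cocycle, cocycle, ← Complex.exp_neg]
  simp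

theorem cocycle_ne_zero (Θ : Matrix (Fin n) (Fin n) ℝ) (p q : Fin n → ℤ) :
    cocycle Θ p q ≠ 0 := Complex.exp_ne_zero _

theorem norm_cocycle (Θ : Matrix (Fin n) (Fin n) ℝ) (p q : Fin n → ℤ) :
    ‖cocycle Θ p q‖ = 1 := by
  rw [cocycle, Complex.norm_exp]
  simp

theorem sum_swap_of_skew {Θ : Matrix (Fin n) (Fin n) ℝ} (hskew : Θᵀ = -Θ) (p q : Fin n → ℤ) :
    ∑ j, ∑ k, Θ j k * (q j : ℝ) * (p k : ℝ) = -∑ j, ∑ k, Θ j k * (p j : ℝ) * (q k : ℝ) := by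
  have hΘ : ∀ j k, Θ k j = -Θ j k := fun j k => congrFun (congrFun hskew j) k
  conv_lhs => rw [Finset.sum_comm]
  simp only [← Finset.sum_neg_distrib]
  refine Finset.sum_congr rfl fun k _ => Finset.sum_congr rfl fun j _ => ?_
  rw [hΘ k j]
  ring

theorem cocycle_swap {Θ : Matrix (Fin n) (Fin n) ℝ} (hskew : Θᵀ = -Θ) (p q : Fin n → ℤ) :
    cocycle Θ q p = (cocycle Θ p q)⁻¹ := by
  rw [cocycle, cocycle, ← Complex.exp_neg, sum_swap_of_skew hskew]
  simp

theorem cocycle_self {Θ : Matrix (Fin n) (Fin n) ℝ} (hskew : Θᵀ = -Θ) (p : Fin n → ℤ) :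
    cocycle Θ p p = 1 := by
  have h0 : ∑ j, ∑ k, Θ j k * (p j : ℝ) * (p k : ℝ) = 0 := by
    linarith [sum_swap_of_skew hskew p p]
  simp [cocycle, h0]

theorem cocycle_single (Θ : Matrix (Fin n) (Fin n) ℝ) (j k : Fin n) :
    cocycle Θ (Pi.single j 1) (Pi.single k 1) =
      Complex.exp (-(Real.pi * Complex.I * (Θ j k : ℂ))) := by
  have h : ∑ a, ∑ b, Θ a b * ((Pi.single j 1 : Fin n → ℤ) a : ℝ) *
      ((Pi.single k 1 : Fin n → ℤ) b : ℝ) = Θ j k := by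
    rw [Finset.sum_eq_single j, Finset.sum_eq_single k]
    · simp
    · intro b _ hb; simp [hb]
    · simp
    · intro a _ ha; simp [ha]
    · simp
  rw [cocycle, h]

theorem cocycle_single_pow_four_ne_one {Θ : Matrix (Fin n) (Fin n) ℝ} {j k : Fin n} (h : ∀ m : ℤ, 4 * Θ j k ≠ (m : ℝ)) :
    cocycle Θ (Pi.single j 1) (Pi.single k 1) ^ 4 ≠ 1 := by
  rw [cocycle_single, ← Complex.exp_nat_mul]
  intro h1
  obtain ⟨m, hm⟩ := Complex.exp_eq_one_iff.1 h1
  refine h (-2 * m) ?_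
  have h2 : (4 * Θ j k : ℂ) * (Real.pi * Complex.I) = (-2 * m) * (Real.pi * Complex.I) := by
    push_cast at hm
    linear_combination -hm
  have h3 := mul_right_cancel₀
    (mul_ne_zero (Complex.ofReal_ne_zero.2 Real.pi_ne_zero) Complex.I_ne_zero) h2
  exact_mod_cast h3

theorem memlp_translate (Θ : Matrix (Fin n) (Fin n) ℝ) (p : Fin n → ℤ) (ξ : EllTwo n) :
    Memℓp (fun r : Fin n → ℤ => (ξ (r - p) * cocycle Θ p (r - p) : ℂ)) 2 := by
  have h := lp.memℓp ξ
  rw [memℓp_gen_iff (by norm_num)] at h ⊢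
  simpa [norm_cocycle, Function.comp_def] using (Equiv.subRight p).summable_iff.mpr h

/-- The twisted translation `ξ ↦ δ_p * ξ`, as an isometry of `ℓ²(ℤⁿ)`. -/
def translate (Θ : Matrix (Fin n) (Fin n) ℝ) (p : Fin n → ℤ) : EllTwo n →ₗᵢ[ℂ] EllTwo n where
  toFun ξ := ⟨fun r => ξ (r - p) * cocycle Θ p (r - p), memlp_translate Θ p ξ⟩
  map_add' ξ η := by ext r; exact add_mul (ξ (r - p)) (η (r - p)) (cocycle Θ p (r - p))
  map_smul' c ξ := by ext r; exact mul_assoc c (ξ (r - p)) (cocycle Θ p (r - p))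
  norm_map' ξ := by
    rw [lp.norm_eq_tsum_rpow (by norm_num), lp.norm_eq_tsum_rpow (by norm_num)]
    congr 1
    rw [← (Equiv.subRight p).tsum_eq fun r => ‖ξ r‖ ^ (2 : ENNReal).toReal]
    refine tsum_congr fun r => ?_
    change ‖ξ (r - p) * cocycle Θ p (r - p)‖ ^ _ = ‖ξ (r - p)‖ ^ _
    rw [norm_mul, norm_cocycle, mul_one]

theorem translate_mem_smoothOperators (Θ : Matrix (Fin n) (Fin n) ℝ) (p : Fin n → ℤ) :
    (translate Θ p).toContinuousLinearMap ∈ smoothOperators Θ := by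
  refine ⟨Pi.single p 1, fun k => ⟨(1 + ‖p‖) ^ k, fun q => ?_⟩, fun ξ r => ?_⟩
  · by_cases h : q = p
    · simp [h]
    · rw [Pi.single_eq_of_ne h, norm_zero, mul_zero]
      positivity
  · rw [tsum_eq_single p fun q hq => by rw [Pi.single_eq_of_ne hq, zero_mul, zero_mul],
      Pi.single_eq_same, one_mul]
    rfl

/-- The element `U_p` of the noncommutative torus with the Fourier coefficients `δ_p`. -/
def weyl (Θ : Matrix (Fin n) (Fin n) ℝ) (p : Fin n → ℤ) : torus Θ :=
  ⟨(translate Θ p).toContinuousLinearMap, StarSubalgebra.le_topologicalClosure _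
    (StarAlgebra.subset_adjoin ℂ _ (translate_mem_smoothOperators Θ p))⟩

theorem weyl_mul_weyl (Θ : Matrix (Fin n) (Fin n) ℝ) (p q : Fin n → ℤ) :
    weyl Θ p * weyl Θ q = cocycle Θ p q • weyl Θ (p + q) := by
  refine Subtype.ext (ContinuousLinearMap.ext fun ξ => lp.ext (funext fun r => ?_))
  change ξ (r - p - q) * cocycle Θ q (r - p - q) * cocycle Θ p (r - p) =
    cocycle Θ p q * (ξ (r - (p + q)) * cocycle Θ (p + q) (r - (p + q)))
  have h : r - p = q + (r - (p + q)) := by abel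
  rw [sub_sub, cocycle_add_left, h, cocycle_add_right]
  ring

theorem weyl_zero (Θ : Matrix (Fin n) (Fin n) ℝ) : weyl Θ 0 = 1 := by
  refine Subtype.ext (ContinuousLinearMap.ext fun ξ => lp.ext (funext fun r => ?_))
  change ξ (r - 0) * cocycle Θ 0 (r - 0) = ξ r
  simp [cocycle]

theorem weyl_mul_weyl_neg {Θ : Matrix (Fin n) (Fin n) ℝ} (hskew : Θᵀ = -Θ) (p : Fin n → ℤ) :
    weyl Θ p * weyl Θ (-p) = 1 := by
  rw [weyl_mul_weyl, cocycle_neg_right, cocycle_self hskew, add_neg_cancel, weyl_zero, inv_one,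
    one_smul]

theorem weyl_conj {Θ : Matrix (Fin n) (Fin n) ℝ} (hskew : Θᵀ = -Θ) (p q : Fin n → ℤ) :
    weyl Θ q * weyl Θ p * weyl Θ (-q) = cocycle Θ q p ^ 2 • weyl Θ p := by
  rw [weyl_mul_weyl, smul_mul_assoc, weyl_mul_weyl, smul_smul, cocycle_neg_right,
    cocycle_add_left, cocycle_self hskew, cocycle_swap hskew q p, one_mul, inv_inv,
    add_neg_cancel_comm, sq]

theorem flip_weyl (Θ : Matrix (Fin n) (Fin n) ℝ) (p : Fin n → ℤ) :
    flip Θ (weyl Θ p) = weyl Θ (-p) := by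
  refine Subtype.ext (ContinuousLinearMap.ext fun ξ => lp.ext (funext fun r => ?_))
  change ξ (-(-r - p)) * cocycle Θ p (-r - p) = ξ (r - -p) * cocycle Θ (-p) (r - -p)
  have h : -r - p = -(r - -p) := by abel
  rw [h, neg_neg, cocycle_neg_left, cocycle_neg_right]

/-- If `U_p` and `U_q` commute up to a scalar other than `1` and `-1`, then the fixed-point algebra
of the flip is Morita equivalent to the crossed product. -/
theorem moritaEquivalent_symmetrizedTorus {Θ : Matrix (Fin n) (Fin n) ℝ} (hskew : Θᵀ = -Θ)
    {p q : Fin n → ℤ} (hpq : cocycle Θ q p ^ 4 ≠ 1) :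
    MoritaEquivalent (symmetrizedTorus Θ) (CrossedProduct (flipAction Θ)) := by
  have hz0 : cocycle Θ q p ^ 2 ≠ 0 := pow_ne_zero _ (cocycle_ne_zero Θ q p)
  have hz : (cocycle Θ q p ^ 2)⁻¹ - cocycle Θ q p ^ 2 ≠ 0 := fun h => hpq <| by
    have h1 := mul_inv_cancel₀ hz0
    rw [sub_eq_zero.1 h] at h1
    rw [← h1]
    ring
  refine CrossedProduct.moritaEquivalent_of_full (symmetrizedTorus Θ).subtype
    Subtype.val_injective (fun a => ⟨?_, fun ha => ⟨⟨a, ha⟩, rfl⟩⟩)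
    (CrossedProduct.one_mem_span_mulAverage (U := weyl Θ p) (U' := weyl Θ (-p)) (V := weyl Θ q)
      (V' := weyl Θ (-q)) hz ?_ (weyl_conj hskew p q) ?_ ?_ ?_)
  · rintro ⟨c, rfl⟩
    exact c.2
  · simpa using weyl_mul_weyl_neg hskew (-p)
  · rw [weyl_conj hskew (-p) q, cocycle_neg_right, inv_pow]
  · exact (flip_weyl Θ (-p)).trans (by rw [neg_neg])
  · exact (flip_weyl Θ (-q)).trans (by rw [neg_neg])

end NCTorus

end

theorem theorem1 {n : ℕ} (Θ : Matrix (Fin n) (Fin n) ℝ) (hskew : Θᵀ = -Θ)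
    (hΘ : ∃ j k, ∀ m : ℤ, 4 * Θ j k ≠ (m : ℝ)) :
    MoritaEquivalent (NCTorus.symmetrizedTorus Θ) (CrossedProduct (NCTorus.flipAction Θ)) := by
  obtain ⟨j, k, hjk⟩ := hΘ
  exact NCTorus.moritaEquivalent_symmetrizedTorus hskew
    (NCTorus.cocycle_single_pow_four_ne_one hjk)
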